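/- Let $k\ge 0$ be an integer and let $Q_0,\dots,Q_k\in\mathbb{C}[z]$ with $\deg Q_i\le i$, $Q_i(z)=\sum_{j=0}^{i}a_{i,j}z^j$. Consider the homogenized spectral pencil $$T_\lambda=\sum_{i=0}^{k}Q_i(z)\,\lambda^{k-i}\frac{d^i}{dz^i},\qquad \lambda\in\mathbb{C}.$$ A nonzero polynomial $p$ with $T_\lambda p=0$ is called an eigenpolynomial with eigenvalue $\lambda$. Assume that the pencil is of general type, that is: $a_{k,k}\neq0$, the characteristic equation $$a_{k,k}+a_{k-1,k-1}t+\dots+a_{0,0}t^k=0$$ has $k$ distinct solutions in $\mathbb{C}$ (so that $a_{0,0}\ne 0$), and no two of them lie on a real line through the origin. Then the roots of the eigenpolynomials lie in a disk centered at the origin, in the following sense. (1) There is $R>0$, depending only on the pencil, such that $|z|\le R$ for every root $z$ of every eigenpolynomial of sufficiently large degree $n\ge N$ (where $N$ depends only on the pencil, and whatever the eigenvalue is), and also for every root $z$ of every eigenpolynomial $p$, of any degree, whose eigenvalue $\lambda$ is such that all polynomial solutions $q$ of $T_\lambda q=0$ are constant multiples of $p$. (2) For any families $(\lambda_{n,j})$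 and $(p_{n,j})$, $n\ge0$, $1\le j\le k$, of complex numbers and polynomials there is $R>0$ such that, for all those pairs $(n,j)$ for which $p_{n,j}$ is an eigenpolynomial of degree exactly $n$ with eigenvalue $\lambda_{n,j}$, all roots of $p_{n,j}$ lie in the disk $|z|\le R$. -/

import Mathlib

open Polynomial

/-- The coefficients `Q_0, …, Q_k` of a homogenized spectral pencil
`T_λ = ∑ i ∈ {0, …, k}, Q_i(z) λ^(k - i) (d/dz)^i`, where `deg Q_i ≤ i`. -/
structure HomogenizedPencil (k : ℕ) where
  Q : Fin (k + 1) → ℂ[X]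
  natDegree_le : ∀ i, (Q i).natDegree ≤ (i : ℕ)

namespace HomogenizedPencil

variable {k : ℕ}

/-- The operator `T_λ` acting on polynomials. -/
noncomputable def op (T : HomogenizedPencil k) (lam : ℂ) (p : ℂ[X]) : ℂ[X] :=
  ∑ i : Fin (k + 1), T.Q i * C (lam ^ (k - (i : ℕ))) * derivative^[(i : ℕ)] p

/-- The polynomial `a_{k,k} + a_{k-1,k-1} t + ⋯ + a_{0,0} t^k` of the characteristic equation,
where `a_{i,j}` is the coefficient of `z^j` in `Q_i`. -/
noncomputable def charPoly (T : HomogenizedPencil k) : ℂ[X] :=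
  ∑ i : Fin (k + 1), C ((T.Q i).coeff (i : ℕ)) * X ^ (k - (i : ℕ))

/-- A pencil of general type: `deg Q_k = k`, the characteristic equation has `k` distinct
solutions, and no two of them lie on a real line through the origin. -/
structure IsGeneralType (T : HomogenizedPencil k) : Prop where
  leading_ne_zero : (T.Q (Fin.last k)).coeff k ≠ 0
  ncard_roots : {t : ℂ | T.charPoly.IsRoot t}.ncard = k
  not_collinear : ∀ a b : ℂ, T.charPoly.IsRoot a → T.charPoly.IsRoot b → a ≠ b →
    ¬ Collinear ℝ {0, a, b}

/-- `p` is a (generalized) eigenpolynomial of the pencil with (generalized) eigenvalue `lam`. -/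
def IsEigenpolynomial (T : HomogenizedPencil k) (lam : ℂ) (p : ℂ[X]) : Prop :=
  p ≠ 0 ∧ T.op lam p = 0

/-- `p` spans the space of all polynomial solutions of `T_λ q = 0`: it is an eigenpolynomial,
and every polynomial solution is a constant multiple of it. -/
def IsUniqueEigenpolynomial (T : HomogenizedPencil k) (lam : ℂ) (p : ℂ[X]) : Prop :=
  T.IsEigenpolynomial lam p ∧ ∀ q : ℂ[X], T.op lam q = 0 → ∃ c : ℂ, q = C c * p

end HomogenizedPencil

/-! Let `p` be an eigenpolynomial of degree `n`, and put `δ = 1 / n`, `t = δ * lam`. At infinity `z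
p' / (n p) = 1 + v`, where the coefficient of `z ^ (-m)` in `v` is `δ` times the `m`-th power sum of
the roots. A bound `‖v m‖ ≤ R ^ m` with `R` independent of `n` therefore confines all the roots to
one disk.

The quotients `Y i = z ^ i p ^ (i) / (n ^ i p)` are differential polynomials in `v`, and `T_λ p = 0`
divided by `n ^ k p` becomes a Riccati-type equation. Its constant coefficient is an equation for
`t` with `a_{0,0} ≠ 0` in front of `t ^ k`, so `t` stays bounded. Its `m`-th coefficient has the
form `D * v m = (terms in lower coefficients)`, where `D = ∑ a_{i,i} t ^ (k - i) fallingDiff δ s i`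
and `s = m * δ`.

For `δ = 0` put `χ x = ∑ a_{i,i} t ^ (k - i) x ^ i`; then `χ 1 = 0` and `D = (χ 1 - χ (1 - s)) / s`.
If `D = 0` with `s ≠ 0, 1`, then `t / (1 - s)` is a second characteristic root on the real line
through `t`, which is excluded; `s = 0` would make `t` a double root, and `s = 1` would force
`a_{0,0} t ^ k = 0`. Compactness, with `s = ∞` included, gives `‖D‖ ≥ c (1 + s) ^ (k - 1)` for all
small `δ` (`exists_le_norm_sum_fallingDiff`). The right-hand sides grow no faster in `s`, so a
majorant argument closes uniformly in `n` (`IsRiccatiFamily.exists_norm_le`).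

In each remaining degree only finitely many eigenvalues occur, hence finitely many roots under
either assumption of the theorem. -/

/-! ### Falling factorials and their divided differences -/

/-- The falling factorial `n (n - 1) ⋯ (n - i + 1) / n ^ i` as a function of `δ = 1 / n`. -/
def scaledFalling (δ : ℝ) : ℕ → ℝ
  | 0 => 1
  | i + 1 => (1 - i * δ) * scaledFalling δ i

/-- The divided difference of falling factorials at `1` and `1 - s`, with step `δ`. -/
def fallingDiff (δ s : ℝ) : ℕ → ℝ
  | 0 => 0
  | i + 1 => (1 - s - i * δ) * fallingDiff δ s i + scaledFalling δ i

/-- The polynomial in `τ = 1 / (1 + s)` obtained from `fallingDiff` by homogenization. -/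
def fallingDiffHom (δ τ : ℝ) : ℕ → ℝ
  | 0 => 0
  | i + 1 => (τ - (1 - τ) - i * δ * τ) * fallingDiffHom δ τ i + τ ^ i * scaledFalling δ i

/-- Passing to `τ` turns the half-line `0 ≤ s` into a bounded interval, with `τ = 0` standing for `s
= ∞`. -/
theorem fallingDiffHom_mul_pow {δ s τ : ℝ} (h : τ * (1 + s) = 1) (i : ℕ) :
    fallingDiffHom δ τ i * (1 + s) ^ i = (1 + s) * fallingDiff δ s i := by
  induction i with
  | zero => simp [fallingDiffHom, fallingDiff]
  | succ i ih =>
    have h1 : τ ^ i * (1 + s) ^ i = 1 := by rw [← mul_pow, h, one_pow]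
    have h2 : (τ - (1 - τ) - i * δ * τ) * (1 + s) = 1 - s - i * δ := by
      linear_combination (2 - i * δ) * h
    calc fallingDiffHom δ τ (i + 1) * (1 + s) ^ (i + 1)
        = ((τ - (1 - τ) - i * δ * τ) * (1 + s)) * (fallingDiffHom δ τ i * (1 + s) ^ i)
          + (τ ^ i * (1 + s) ^ i) * (1 + s) * scaledFalling δ i := by
            simp only [fallingDiffHom]; ring
      _ = _ := by rw [h1, h2, ih, fallingDiff]; ring

theorem scaledFalling_zero (i : ℕ) : scaledFalling 0 i = 1 := by
  induction i with
  | zero => rfl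
  | succ i ih => simp [scaledFalling, ih]

theorem fallingDiffHom_zero_mul (τ : ℝ) (i : ℕ) :
    (1 - τ) * fallingDiffHom 0 τ i = τ ^ i - (2 * τ - 1) ^ i := by
  induction i with
  | zero => simp [fallingDiffHom]
  | succ i ih =>
    simp only [fallingDiffHom, scaledFalling_zero]
    linear_combination (2 * τ - 1) * ih

theorem fallingDiffHom_zero_one (i : ℕ) : fallingDiffHom 0 1 i = i := by
  induction i with
  | zero => simp [fallingDiffHom]
  | succ i ih => simp [fallingDiffHom, scaledFalling_zero, ih]

theorem continuous_scaledFalling (i : ℕ) : Continuous fun δ => scaledFalling δ i := by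
  induction i with
  | zero => exact continuous_const
  | succ i ih => simp only [scaledFalling]; fun_prop

theorem continuous_fallingDiffHom (i : ℕ) :
    Continuous fun x : ℝ × ℝ => fallingDiffHom x.1 x.2 i := by
  induction i with
  | zero => exact continuous_const
  | succ i ih =>
    have := continuous_scaledFalling i
    simp only [fallingDiffHom]; fun_prop

/-! ### The characteristic equation and nonresonance -/

namespace HomogenizedPencil

variable {k : ℕ} {T : HomogenizedPencil k}

/-- The leading coefficient `a_{i,i}`. -/
noncomputable def lead (T : HomogenizedPencil k) (i : Fin (k + 1)) : ℂ := (T.Q i).coeff i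

theorem eval_charPoly (T : HomogenizedPencil k) (t : ℂ) :
    T.charPoly.eval t = ∑ i, T.lead i * t ^ (k - (i : ℕ)) := by
  simp [charPoly, lead, eval_finsetSum]

theorem natDegree_charPoly_le (T : HomogenizedPencil k) : T.charPoly.natDegree ≤ k :=
  natDegree_sum_le_of_forall_le _ _ fun _ _ =>
    (natDegree_C_mul_X_pow_le _ _).trans (Nat.sub_le _ _)

theorem coeff_charPoly (T : HomogenizedPencil k) : T.charPoly.coeff k = T.lead 0 := by
  simp only [charPoly, finsetSum_coeff, coeff_C_mul, coeff_X_pow]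
  rw [Finset.sum_eq_single 0]
  · simp [lead]
  · intro i _ hi
    have : (i : ℕ) ≠ 0 := fun h => hi (Fin.ext h)
    rw [if_neg (by have := i.is_lt; omega), mul_zero]
  · simp

namespace IsGeneralType

theorem eval_zero_ne (hT : T.IsGeneralType) : T.charPoly.eval 0 ≠ 0 := by
  rw [eval_charPoly, Finset.sum_eq_single (Fin.last k)]
  · simpa [lead] using hT.leading_ne_zero
  · intro i _ hi
    have : (i : ℕ) ≠ k := fun h => hi (Fin.ext h)
    rw [zero_pow (by have := i.is_lt; omega), mul_zero]
  · simp

theorem charPoly_ne_zero (hT : T.IsGeneralType) : T.charPoly ≠ 0 := fun h =>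
  hT.eval_zero_ne (by simp [h])

theorem card_toFinset_roots (hT : T.IsGeneralType) : T.charPoly.roots.toFinset.card = k := by
  refine Eq.trans ?_ hT.ncard_roots
  rw [← Set.ncard_coe_finset]
  congr 1
  ext t
  simp [hT.charPoly_ne_zero]

theorem lead_zero_ne (hT : T.IsGeneralType) : T.lead 0 ≠ 0 := by
  have h1 : k ≤ T.charPoly.natDegree := by
    calc k = _ := hT.card_toFinset_roots.symm
      _ ≤ _ := Multiset.toFinset_card_le _
      _ ≤ _ := card_roots' _
  have h2 := le_antisymm T.natDegree_charPoly_le h1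
  rw [← coeff_charPoly]
  nth_rw 2 [← h2]
  simpa using hT.charPoly_ne_zero

/-- Having `k` distinct roots and degree at most `k`, the characteristic polynomial has only simple
roots. -/
theorem derivative_ne_zero (hT : T.IsGeneralType) {t : ℂ} (ht : T.charPoly.IsRoot t) :
    T.charPoly.derivative.eval t ≠ 0 := by
  intro h
  have h1 := (one_lt_rootMultiplicity_iff_isRoot hT.charPoly_ne_zero).2 ⟨ht, h⟩
  have h2 : T.charPoly.roots.Nodup := by
    rw [← Multiset.toFinset_card_eq_card_iff_nodup]
    refine le_antisymm (Multiset.toFinset_card_le _) ?_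
    rw [hT.card_toFinset_roots]
    exact (card_roots' _).trans T.natDegree_charPoly_le
  rw [← count_roots] at h1
  exact absurd (Multiset.nodup_iff_count_le_one.1 h2 t) (by omega)

/-- At a root the sum equals `-t` times the derivative of the characteristic polynomial. This is
nonresonance at `s = 0`. -/
theorem sum_lead_mul_index_ne (hT : T.IsGeneralType) {t : ℂ} (ht : T.charPoly.IsRoot t) :
    ∑ i : Fin (k + 1), T.lead i * t ^ (k - (i : ℕ)) * (i : ℕ) ≠ 0 := by
  intro h
  have ht0 : t ≠ 0 := by rintro rfl; exact hT.eval_zero_ne ht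
  have h1 : t * T.charPoly.derivative.eval t
      = ∑ i : Fin (k + 1), T.lead i * t ^ (k - (i : ℕ)) * ((k : ℂ) - (i : ℕ)) := by
    simp only [charPoly, derivative_sum, eval_finsetSum, Finset.mul_sum]
    refine Finset.sum_congr rfl fun i _ => ?_
    obtain ⟨j, hj⟩ := Nat.exists_eq_add_of_le (Nat.le_of_lt_succ i.is_lt)
    have hj' : k - (i : ℕ) = j := by omega
    have hc : (k : ℂ) - (i : ℕ) = j := by
      have : (k : ℂ) = (i : ℕ) + j := by exact_mod_cast hj
      rw [this]; ring
    rw [hj', hc]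
    rcases j with _ | j
    · simp
    · simp [lead]; ring
  have h2 : ∑ i : Fin (k + 1), T.lead i * t ^ (k - (i : ℕ)) * ((k : ℂ) - (i : ℕ)) = 0 := by
    simp only [mul_sub, Finset.sum_sub_distrib]
    rw [h, ← Finset.sum_mul, ← eval_charPoly, ht.eq_zero]; simp
  rw [h2] at h1
  exact (mul_ne_zero ht0 (hT.derivative_ne_zero ht)) h1

/-- No root of the characteristic polynomial other than `t` is a real multiple of `t`. -/
theorem eq_one_of_isRoot_mul (hT : T.IsGeneralType) {t : ℂ} (ht : T.charPoly.IsRoot t) {r : ℝ}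
    (hr : T.charPoly.IsRoot (r * t)) : r = 1 := by
  have ht0 : t ≠ 0 := by rintro rfl; exact hT.eval_zero_ne ht
  by_contra h
  refine hT.not_collinear t (r * t) ht hr (fun e => h ?_) ?_
  · have : ((r : ℂ) - 1) * t = 0 := by linear_combination -e
    rcases mul_eq_zero.1 this with h' | h'
    · exact_mod_cast sub_eq_zero.1 h'
    · exact absurd h' ht0
  · rw [collinear_iff_of_mem (p₀ := (0 : ℂ)) (by simp)]
    refine ⟨t, ?_⟩
    rintro p (rfl | rfl | rfl)
    · exact ⟨0, by simp⟩
    · exact ⟨1, by simp⟩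
    · exact ⟨r, by simp⟩

/-- Multiplied by `1 - τ`, the sum is a difference of two homogenized characteristic sums. The one
at `τ` vanishes with `t`, so the one at `2 * τ - 1` would vanish too, producing a forbidden real
multiple of `t`. -/
theorem sum_fallingDiffHom_ne (hT : T.IsGeneralType) {t : ℂ}
    (ht : T.charPoly.IsRoot t) (τ : ℝ) :
    ∑ i : Fin (k + 1), T.lead i * t ^ (k - (i : ℕ)) *
      ((τ ^ (k - (i : ℕ)) * fallingDiffHom 0 τ i : ℝ) : ℂ) ≠ 0 := by
  intro h
  have ht0 : t ≠ 0 := by rintro rfl; exact hT.eval_zero_ne ht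
  rcases eq_or_ne τ 1 with rfl | hτ
  · refine hT.sum_lead_mul_index_ne ht ?_
    simpa [fallingDiffHom_zero_one] using h
  have key : ∑ i : Fin (k + 1), T.lead i * (t * τ) ^ (k - (i : ℕ)) * (2 * τ - 1 : ℂ) ^ (i : ℕ)
      = 0 := by
    have h1 : ∑ i : Fin (k + 1), T.lead i * t ^ (k - (i : ℕ)) * (τ : ℂ) ^ k = 0 := by
      rw [← Finset.sum_mul, ← eval_charPoly, ht.eq_zero, zero_mul]
    have h2 := congrArg (fun x => (1 - (τ : ℂ)) * x) h
    simp only [Finset.mul_sum, mul_zero] at h2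
    rw [← sub_eq_zero.2 (h1.trans h2.symm), ← Finset.sum_sub_distrib]
    refine Finset.sum_congr rfl fun i _ => ?_
    have e : (1 - (τ : ℂ)) * fallingDiffHom 0 τ i = (τ : ℂ) ^ (i : ℕ) - (2 * τ - 1) ^ (i : ℕ) := by
      exact_mod_cast fallingDiffHom_zero_mul τ i
    have e2 : (τ : ℂ) ^ k = τ ^ (k - (i : ℕ)) * τ ^ (i : ℕ) := by
      rw [← pow_add, Nat.sub_add_cancel (Nat.le_of_lt_succ i.is_lt)]
    push_cast
    rw [e2, mul_pow]
    linear_combination (T.lead i * t ^ (k - (i : ℕ)) * τ ^ (k - (i : ℕ))) * e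
  -- This is `s = 1`: only the term of `a_{0,0}` survives.
  rcases eq_or_ne (2 * τ - 1) 0 with h0 | h0
  · have h0' : (2 * τ - 1 : ℂ) = 0 := by exact_mod_cast h0
    rw [h0', Finset.sum_eq_single 0] at key
    · have hτ0 : τ ≠ 0 := by rintro rfl; norm_num at h0
      have : (τ : ℂ) ≠ 0 := by exact_mod_cast hτ0
      simp [hT.lead_zero_ne, ht0, this] at key
    · intro i _ hi
      have : (i : ℕ) ≠ 0 := fun h => hi (Fin.ext h)
      rw [zero_pow this, mul_zero]
    · simp
  · have h0' : (2 * τ - 1 : ℂ) ≠ 0 := by exact_mod_cast h0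
    have hr : T.charPoly.IsRoot ((τ / (2 * τ - 1) : ℝ) * t) := by
      rw [IsRoot, eval_charPoly]
      have : (2 * τ - 1 : ℂ) ^ k * ∑ i : Fin (k + 1), T.lead i *
          ((τ / (2 * τ - 1) : ℝ) * t) ^ (k - (i : ℕ)) = 0 := by
        rw [← key, Finset.mul_sum]
        refine Finset.sum_congr rfl fun i _ => ?_
        have e2 : (2 * τ - 1 : ℂ) ^ k = (2 * τ - 1) ^ (k - (i : ℕ)) * (2 * τ - 1) ^ (i : ℕ) := by
          rw [← pow_add, Nat.sub_add_cancel (Nat.le_of_lt_succ i.is_lt)]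
        have e3 : (2 * τ - 1 : ℂ) ^ (k - (i : ℕ)) * ((τ / (2 * τ - 1) : ℝ) * t) ^ (k - (i : ℕ))
            = (t * τ) ^ (k - (i : ℕ)) := by
          rw [← mul_pow]
          congr 1
          push_cast
          field_simp
        rw [e2]
        linear_combination (T.lead i * (2 * τ - 1) ^ (i : ℕ)) * e3
      exact (mul_eq_zero.1 this).resolve_left (pow_ne_zero _ h0')
    have := hT.eq_one_of_isRoot_mul ht hr
    rw [div_eq_one_iff_eq h0] at this
    exact hτ (by linarith)

/-- The linearized recursion is uniformly nonresonant. -/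
theorem exists_le_norm_sum_fallingDiff (hT : T.IsGeneralType) (hk : k ≠ 0) (B : ℝ) :
    ∃ c > 0, ∀ (δ s : ℝ) (t : ℂ), 0 ≤ δ → δ ≤ c → 0 ≤ s → ‖t‖ ≤ B →
      ∑ i : Fin (k + 1), T.lead i * t ^ (k - (i : ℕ)) * (scaledFalling δ i : ℂ) = 0 →
      c * (1 + s) ^ (k - 1) ≤
        ‖∑ i : Fin (k + 1), T.lead i * t ^ (k - (i : ℕ)) * (fallingDiff δ s i : ℂ)‖ := by
  set E : ℝ × ℂ → ℂ := fun x =>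
    ∑ i : Fin (k + 1), T.lead i * x.2 ^ (k - (i : ℕ)) * (scaledFalling x.1 i : ℂ) with hE
  set H : (ℝ × ℝ) × ℂ → ℂ := fun x => ∑ i : Fin (k + 1), T.lead i * x.2 ^ (k - (i : ℕ)) *
      ((x.1.2 ^ (k - (i : ℕ)) * fallingDiffHom x.1.1 x.1.2 i : ℝ) : ℂ) with hH
  have hEc : Continuous E := by
    refine continuous_finsetSum _ fun i _ => ?_
    have := continuous_scaledFalling i
    fun_prop
  have hHc : Continuous H := by
    refine continuous_finsetSum _ fun i _ => ?_
    have := continuous_fallingDiffHom i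
    fun_prop
  -- `g` can vanish only at `δ = 0`, `E = 0`, `H = 0`, which the limiting case excludes; so it has a
  -- positive minimum on the compact set `S`.
  set g : (ℝ × ℝ) × ℂ → ℝ := fun x => x.1.1 + (‖E (x.1.1, x.2)‖ + ‖H x‖) with hg
  have hgc : Continuous g := by fun_prop
  set S : Set ((ℝ × ℝ) × ℂ) :=
    (Set.Icc (0 : ℝ) 1 ×ˢ Set.Icc (0 : ℝ) 1) ×ˢ Metric.closedBall (0 : ℂ) B with hS
  have hSc : IsCompact S := (isCompact_Icc.prod isCompact_Icc).prod (isCompact_closedBall _ _)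
  have hpos : ∀ x ∈ S, 0 < g x := by
    rintro ⟨⟨δ, τ⟩, t⟩ hx
    have hδ : 0 ≤ δ := hx.1.1.1
    by_contra hle
    have hle : δ + (‖E (δ, t)‖ + ‖H ((δ, τ), t)‖) ≤ 0 := not_lt.1 hle
    have n1 := norm_nonneg (E (δ, t))
    have n2 := norm_nonneg (H ((δ, τ), t))
    obtain rfl : δ = 0 := by linarith
    have e1 : E (0, t) = 0 := norm_le_zero_iff.1 (by linarith)
    have e2 : H ((0, τ), t) = 0 := norm_le_zero_iff.1 (by linarith)
    refine hT.sum_fallingDiffHom_ne (t := t) ?_ τ e2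
    rw [IsRoot, eval_charPoly, ← e1]
    simp [hE, scaledFalling_zero]
  obtain ⟨c, hc, hcg⟩ : ∃ c > 0, ∀ x ∈ S, c ≤ g x := by
    rcases S.eq_empty_or_nonempty with he | hne
    · exact ⟨1, one_pos, by simp [he]⟩
    · obtain ⟨x, hx, hmin⟩ := hSc.exists_isMinOn hne hgc.continuousOn
      exact ⟨g x, hpos x hx, fun y hy => hmin hy⟩
  -- Here `E = 0`, and `δ ≤ c / 2` uses up half of the minimum, leaving `c / 2` for `H`; the cap `1`
  -- keeps `δ` inside `S`.
  refine ⟨min 1 (c / 2), by positivity, fun δ s t hδ hδc hs ht h0 => ?_⟩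
  have hs1 : 0 < 1 + s := by linarith
  set τ := (1 + s)⁻¹ with hτ
  have hτs : τ * (1 + s) = 1 := inv_mul_cancel₀ hs1.ne'
  have hτ0 : 0 ≤ τ := by positivity
  have hτ1 : τ ≤ 1 := inv_le_one_of_one_le₀ (by linarith)
  have h1 := hcg ((δ, τ), t) ⟨⟨⟨hδ, hδc.trans (min_le_left _ _)⟩, hτ0, hτ1⟩, by simpa using ht⟩
  have h2 : E (δ, t) = 0 := h0
  have h3 : c ≤ δ + (‖E (δ, t)‖ + ‖H ((δ, τ), t)‖) := h1
  rw [h2, norm_zero, zero_add] at h3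
  have h4 : min 1 (c / 2) ≤ ‖H ((δ, τ), t)‖ := by
    have := hδc.trans (min_le_right _ _)
    exact (min_le_right _ _).trans (by linarith)
  have h5 : H ((δ, τ), t) * (((1 + s) ^ k : ℝ) : ℂ) = ((1 + s : ℝ) : ℂ) *
      ∑ i : Fin (k + 1), T.lead i * t ^ (k - (i : ℕ)) * (fallingDiff δ s i : ℂ) := by
    simp only [hH, Finset.sum_mul, Finset.mul_sum]
    refine Finset.sum_congr rfl fun i _ => ?_
    have e1 : (1 + s) ^ k = (1 + s) ^ (k - (i : ℕ)) * (1 + s) ^ (i : ℕ) := by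
      rw [← pow_add, Nat.sub_add_cancel (Nat.le_of_lt_succ i.is_lt)]
    have e2 : τ ^ (k - (i : ℕ)) * fallingDiffHom δ τ i * (1 + s) ^ k
        = (1 + s) * fallingDiff δ s i := by
      rw [e1, ← fallingDiffHom_mul_pow hτs]
      have : τ ^ (k - (i : ℕ)) * (1 + s) ^ (k - (i : ℕ)) = 1 := by rw [← mul_pow, hτs, one_pow]
      linear_combination (fallingDiffHom δ τ i * (1 + s) ^ (i : ℕ)) * this
    have e3 : ((τ ^ (k - (i : ℕ)) * fallingDiffHom δ τ i : ℝ) : ℂ) * (((1 + s) ^ k : ℝ) : ℂ)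
        = ((1 + s : ℝ) : ℂ) * (fallingDiff δ s i : ℂ) := by exact_mod_cast e2
    linear_combination (T.lead i * t ^ (k - (i : ℕ))) * e3
  have h6 := congrArg norm h5
  rw [norm_mul, norm_mul, Complex.norm_of_nonneg (by positivity),
    Complex.norm_of_nonneg hs1.le] at h6
  refine le_of_mul_le_mul_left ?_ hs1
  rw [← h6, mul_left_comm, ← pow_succ', Nat.sub_add_cancel (Nat.one_le_iff_ne_zero.2 hk)]
  gcongr

/-- Solutions `t = λ / n` of the leading coefficient equation are bounded. -/
theorem exists_norm_le (hT : T.IsGeneralType) : ∃ B : ℝ, 1 ≤ B ∧ ∀ (t : ℂ)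
    (y : Fin (k + 1) → ℂ), (∀ i, ‖y i‖ ≤ 1) → y 0 = 1 →
      ∑ i : Fin (k + 1), T.lead i * t ^ (k - (i : ℕ)) * y i = 0 → ‖t‖ ≤ B := by
  have h0 : 0 < ‖T.lead 0‖ := norm_pos_iff.2 hT.lead_zero_ne
  refine ⟨max 1 ((∑ i : Fin k, ‖T.lead i.succ‖) / ‖T.lead 0‖), le_max_left _ _,
    fun t y hy hy0 h => ?_⟩
  by_contra hlt
  rw [not_le, max_lt_iff, div_lt_iff₀ h0] at hlt
  obtain ⟨h1, h2⟩ := hlt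
  rw [Fin.sum_univ_succ, hy0] at h
  have h3 : T.lead 0 * t ^ k
      = - ∑ i : Fin k, T.lead i.succ * t ^ (k - (i.succ : ℕ)) * y i.succ := by
    simpa using eq_neg_of_add_eq_zero_left h
  have h4 : ‖T.lead 0‖ * ‖t‖ ^ k ≤ (∑ i : Fin k, ‖T.lead i.succ‖) * ‖t‖ ^ (k - 1) := by
    rw [← norm_pow, ← norm_mul, h3, norm_neg, Finset.sum_mul]
    refine norm_sum_le_of_le _ fun i _ => ?_
    rw [norm_mul, norm_mul, norm_pow]
    have : ‖t‖ ^ (k - (i.succ : ℕ)) ≤ ‖t‖ ^ (k - 1) :=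
      pow_le_pow_right₀ h1.le (by simp; omega)
    calc _ ≤ ‖T.lead i.succ‖ * ‖t‖ ^ (k - 1) * 1 := by gcongr; exact hy _
      _ = _ := mul_one _
  rcases Nat.eq_zero_or_pos k with rfl | hk
  · simp at h4
    exact hT.lead_zero_ne h4
  · have h5 : ‖t‖ ^ k = ‖t‖ * ‖t‖ ^ (k - 1) := by rw [← pow_succ', Nat.sub_add_cancel hk]
    have h6 : 0 < ‖t‖ ^ (k - 1) := by positivity
    rw [h5] at h4
    have h7 := mul_lt_mul_of_pos_right h2 h6
    linarith

end IsGeneralType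

end HomogenizedPencil

/-! ### Majorant estimates for the Riccati hierarchy -/

theorem sum_range_inv_sq_le (n : ℕ) : ∑ i ∈ Finset.range n, ((i : ℝ) ^ 2)⁻¹ ≤ 2 := by
  have h := sum_Ioo_inv_sq_le (α := ℝ) 0 n
  rcases n with _ | n
  · simp
  · rw [Finset.sum_range_succ']
    have : ∑ i ∈ Finset.Ioo 0 (n + 1), ((i : ℝ) ^ 2)⁻¹
        = ∑ i ∈ Finset.range n, (((i + 1 : ℕ) : ℝ) ^ 2)⁻¹ := by
      rw [Finset.range_eq_Ico, Finset.sum_Ico_add' (fun i : ℕ => ((i : ℝ) ^ 2)⁻¹) 0 n 1]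
      rfl
    rw [this] at h
    simpa using h

/-- The weight `m ^ (-2)` is stable under convolution, because `1 / (a b) = (1 / a + 1 / b) / (a +
b)`. Terms with a zero index vanish since `0⁻¹ = 0`. -/
theorem sum_antidiagonal_inv_sq_le (m : ℕ) :
    ∑ x ∈ Finset.HasAntidiagonal.antidiagonal m, ((x.1 : ℝ) ^ 2)⁻¹ * ((x.2 : ℝ) ^ 2)⁻¹ ≤ 8 * ((m : ℝ) ^ 2)⁻¹ := by
  have h1 : ∑ x ∈ Finset.HasAntidiagonal.antidiagonal m, ((x.1 : ℝ) ^ 2)⁻¹ ≤ 2 := by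
    rw [Finset.Nat.sum_antidiagonal_eq_sum_range_succ_mk]
    exact sum_range_inv_sq_le _
  have h2 : ∑ x ∈ Finset.HasAntidiagonal.antidiagonal m, ((x.2 : ℝ) ^ 2)⁻¹ ≤ 2 := by
    rw [← Finset.Nat.sum_antidiagonal_swap]
    exact h1
  have hm : 0 ≤ ((m : ℝ) ^ 2)⁻¹ := by positivity
  calc _ ≤ ∑ x ∈ Finset.HasAntidiagonal.antidiagonal m,
        2 * ((m : ℝ) ^ 2)⁻¹ * (((x.1 : ℝ) ^ 2)⁻¹ + ((x.2 : ℝ) ^ 2)⁻¹) := by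
        refine Finset.sum_le_sum fun x hx => ?_
        obtain ⟨a, b⟩ := x
        obtain rfl : a + b = m := Finset.HasAntidiagonal.mem_antidiagonal.1 hx
        rcases Nat.eq_zero_or_pos a with rfl | ha
        · simp; positivity
        rcases Nat.eq_zero_or_pos b with rfl | hb
        · simp; positivity
        have ha' : (0 : ℝ) < a := by exact_mod_cast ha
        have hb' : (0 : ℝ) < b := by exact_mod_cast hb
        have e : ((a : ℝ) ^ 2)⁻¹ * ((b : ℝ) ^ 2)⁻¹
            = (((a + b : ℕ) : ℝ) ^ 2)⁻¹ * ((a : ℝ)⁻¹ + (b : ℝ)⁻¹) ^ 2 := by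
          push_cast; field_simp; ring
        have e2 : ((a : ℝ)⁻¹ + (b : ℝ)⁻¹) ^ 2 ≤ 2 * (((a : ℝ) ^ 2)⁻¹ + ((b : ℝ) ^ 2)⁻¹) := by
          rw [← inv_pow, ← inv_pow]
          nlinarith [sq_nonneg ((a : ℝ)⁻¹ - (b : ℝ)⁻¹)]
        simp only
        rw [e]
        calc _ ≤ (((a + b : ℕ) : ℝ) ^ 2)⁻¹ * (2 * (((a : ℝ) ^ 2)⁻¹ + ((b : ℝ) ^ 2)⁻¹)) := by gcongr
          _ = _ := by ring
    _ = 2 * ((m : ℝ) ^ 2)⁻¹ * (∑ x ∈ Finset.HasAntidiagonal.antidiagonal m, ((x.1 : ℝ) ^ 2)⁻¹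
        + ∑ x ∈ Finset.HasAntidiagonal.antidiagonal m, ((x.2 : ℝ) ^ 2)⁻¹) := by
        rw [← Finset.sum_add_distrib, Finset.mul_sum]
    _ ≤ 2 * ((m : ℝ) ^ 2)⁻¹ * (2 + 2) := by gcongr
    _ = _ := by ring

/-- The growth constants of the majorant argument. -/
def majConst : ℕ → ℝ
  | 0 => 1
  | i + 1 => (i + 10) * majConst i

theorem majConst_pos (i : ℕ) : 0 < majConst i := by
  induction i with
  | zero => exact one_pos
  | succ i ih => exact mul_pos (by positivity) ih

theorem monotone_majConst : Monotone majConst :=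
  monotone_nat_of_le_succ fun i => by
    have := majConst_pos i
    rw [majConst]
    nlinarith [mul_nonneg (Nat.cast_nonneg (α := ℝ) i) this.le]

theorem abs_scaledFalling_le {δ : ℝ} (h0 : 0 ≤ δ) (h1 : δ ≤ 1) (i : ℕ) :
    |scaledFalling δ i| ≤ majConst i := by
  induction i with
  | zero => simp [scaledFalling, majConst]
  | succ i ih =>
    rw [scaledFalling, majConst, abs_mul]
    have : |1 - i * δ| ≤ i + 10 := by
      have h2 : 0 ≤ i * δ := by positivity
      have h3 : i * δ ≤ i := mul_le_of_le_one_right (Nat.cast_nonneg _) h1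
      rw [abs_le]; constructor <;> linarith
    gcongr

/-- The family of coefficient sequences `Y i` of `z ^ i p ^ (i) / (n ^ i p)` in powers of `1 / z`,
where `1 + v` is the case `i = 1` and `δ = 1 / n`. -/
structure IsRiccatiFamily (δ : ℝ) (v : ℕ → ℂ) (Y : ℕ → ℕ → ℂ) : Prop where
  v_zero : v 0 = 0
  zero_zero : Y 0 0 = 1
  zero_of_ne : ∀ m, m ≠ 0 → Y 0 m = 0
  succ : ∀ i m, Y (i + 1) m = (1 - (i + m) * δ) * Y i m +
    ∑ x ∈ Finset.HasAntidiagonal.antidiagonal m, v x.1 * Y i x.2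

/-- The part of the convolution of `v` and `y` that involves only lower coefficients. -/
noncomputable def crossSum (v y : ℕ → ℂ) (m : ℕ) : ℂ :=
  ∑ x ∈ Finset.HasAntidiagonal.antidiagonal m, if x.2 = 0 then 0 else v x.1 * y x.2

theorem sum_antidiagonal_eq_add_crossSum (v y : ℕ → ℂ) (m : ℕ) :
    ∑ x ∈ Finset.HasAntidiagonal.antidiagonal m, v x.1 * y x.2 = v m * y 0 + crossSum v y m := by
  rcases m with _ | m
  · simp [crossSum]
  · rw [crossSum, Finset.Nat.sum_antidiagonal_succ', Finset.Nat.sum_antidiagonal_succ']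
    simp

theorem norm_crossSum_le {v y : ℕ → ℂ} {m e : ℕ} {δ η R C : ℝ} (hδ : 0 ≤ δ) (hη : 0 ≤ η)
    (hR : 0 ≤ R) (hC : 0 ≤ C)
    (hv0 : v 0 = 0) (hv : ∀ j < m, ‖v j‖ ≤ η * (((j : ℝ) ^ 2)⁻¹ * R ^ j))
    (hy : ∀ j < m, j ≠ 0 → ‖y j‖ ≤ C * (η * (((j : ℝ) ^ 2)⁻¹ * R ^ j)) * (1 + j * δ) ^ e) :
    ‖crossSum v y m‖ ≤ 8 * C * (η * (η * (((m : ℝ) ^ 2)⁻¹ * R ^ m))) * (1 + m * δ) ^ e := by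
  have key : ∀ x ∈ Finset.HasAntidiagonal.antidiagonal m, ‖if x.2 = 0 then 0 else v x.1 * y x.2‖ ≤
      (C * η ^ 2 * R ^ m * (1 + m * δ) ^ e) * (((x.1 : ℝ) ^ 2)⁻¹ * ((x.2 : ℝ) ^ 2)⁻¹) := by
    rintro ⟨a, b⟩ hx
    obtain rfl : a + b = m := Finset.HasAntidiagonal.mem_antidiagonal.1 hx
    simp only
    split_ifs with hb
    · rw [norm_zero]; positivity
    rcases Nat.eq_zero_or_pos a with rfl | ha
    · simp [hv0]
    rw [norm_mul]
    have hle : (b : ℝ) ≤ (a + b : ℕ) := by exact_mod_cast Nat.le_add_left b a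
    calc ‖v a‖ * ‖y b‖ ≤ (η * (((a : ℝ) ^ 2)⁻¹ * R ^ a)) *
          (C * (η * (((b : ℝ) ^ 2)⁻¹ * R ^ b)) * (1 + (a + b : ℕ) * δ) ^ e) := by
          refine mul_le_mul (hv a (by omega)) ((hy b (by omega) hb).trans ?_) (norm_nonneg _)
            (by positivity)
          gcongr
      _ = _ := by rw [pow_add]; ring
  calc _ ≤ _ := norm_sum_le_of_le _ key
    _ = (C * η ^ 2 * R ^ m * (1 + m * δ) ^ e) *
        ∑ x ∈ Finset.HasAntidiagonal.antidiagonal m, ((x.1 : ℝ) ^ 2)⁻¹ * ((x.2 : ℝ) ^ 2)⁻¹ := by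
        rw [Finset.mul_sum]
    _ ≤ (C * η ^ 2 * R ^ m * (1 + m * δ) ^ e) * (8 * ((m : ℝ) ^ 2)⁻¹) := by
        gcongr
        exact sum_antidiagonal_inv_sq_le m
    _ = _ := by ring

/-- Each step costs a factor `1 + i + s ≤ (1 + i) * (1 + s)`, and `(1 + i) + 9 = i + 10` explains
`majConst`. As `u 0 = 0`, the first step costs no power of `1 + s`; this saving makes the exponent
match that of the nonresonance bound. -/
theorem norm_le_majConst_mul {u : ℕ → ℂ} {s W : ℝ} (hs : 0 ≤ s) (hW : 0 ≤ W) (h0 : u 0 = 0)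
    (h : ∀ i, ‖u (i + 1)‖ ≤ (1 + i + s) * ‖u i‖ + 9 * majConst i * W * (1 + s) ^ (i - 1)) (i : ℕ) :
    ‖u i‖ ≤ majConst i * W * (1 + s) ^ (i - 1) := by
  have hs1 : 1 ≤ 1 + s := by linarith
  induction i with
  | zero => rw [h0, norm_zero]; have := majConst_pos 0; positivity
  | succ i ih =>
    have hC := majConst_pos i
    have h1 : (1 + s) * ‖u i‖ ≤ majConst i * W * (1 + s) ^ i := by
      rcases i with _ | i
      · rw [h0, norm_zero]; simp; positivity
      · calc _ ≤ (1 + s) * (majConst (i + 1) * W * (1 + s) ^ (i + 1 - 1)) := by gcongr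
          _ = _ := by rw [Nat.add_sub_cancel, pow_succ]; ring
    have h2 : (1 + s) ^ (i - 1) ≤ (1 + s) ^ i := pow_le_pow_right₀ hs1 (Nat.sub_le _ _)
    calc ‖u (i + 1)‖ ≤ (1 + i + s) * ‖u i‖ + 9 * majConst i * W * (1 + s) ^ (i - 1) := h i
      _ ≤ ((1 + i) * (1 + s)) * ‖u i‖ + 9 * majConst i * W * (1 + s) ^ i := by
        gcongr
        nlinarith [mul_nonneg (Nat.cast_nonneg (α := ℝ) i) hs]
      _ = (1 + i) * ((1 + s) * ‖u i‖) + 9 * majConst i * W * (1 + s) ^ i := by ring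
      _ ≤ (1 + i) * (majConst i * W * (1 + s) ^ i) + 9 * majConst i * W * (1 + s) ^ i := by gcongr
      _ = _ := by rw [majConst, Nat.add_sub_cancel]; ring

namespace IsRiccatiFamily

variable {δ : ℝ} {v : ℕ → ℂ} {Y : ℕ → ℕ → ℂ}

theorem apply_zero (h : IsRiccatiFamily δ v Y) (i : ℕ) : Y i 0 = scaledFalling δ i := by
  induction i with
  | zero => simp [h.zero_zero, scaledFalling]
  | succ i ih => rw [h.succ, ih]; simp [h.v_zero, scaledFalling]

theorem norm_apply_zero_le (h : IsRiccatiFamily δ v Y) (h0 : 0 ≤ δ) (h1 : δ ≤ 1) (i : ℕ) :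
    ‖Y i 0‖ ≤ majConst i := by
  rw [h.apply_zero, Complex.norm_real]
  exact abs_scaledFalling_le h0 h1 i

theorem norm_factor_le (h0 : 0 ≤ δ) (h1 : δ ≤ 1) (i m : ℕ) :
    ‖(1 - (i + m) * δ : ℂ)‖ ≤ 1 + i + m * δ := by
  have e : (1 - (i + m) * δ : ℂ) = ((1 - (i + m) * δ : ℝ) : ℂ) := by push_cast; ring
  have h2 : 0 ≤ i * δ := by positivity
  have h3 : i * δ ≤ i := mul_le_of_le_one_right (Nat.cast_nonneg _) h1
  have h4 : 0 ≤ m * δ := by positivity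
  rw [e, Complex.norm_real, Real.norm_eq_abs, abs_le]
  constructor <;> nlinarith

/-- In the recursion at level `m`, the term `v m * Y i 0` contributes `1` and the convolution of
lower coefficients `8` to the constant `9` of `norm_le_majConst_mul`. -/
theorem norm_apply_le (h : IsRiccatiFamily δ v Y) (h0 : 0 ≤ δ) (h1 : δ ≤ 1) {η R : ℝ}
    (hη0 : 0 ≤ η) (hη1 : η ≤ 1) (hR : 0 ≤ R) {M : ℕ}
    (hv : ∀ j < M, ‖v j‖ ≤ η * (((j : ℝ) ^ 2)⁻¹ * R ^ j)) (m : ℕ) :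
    m < M → m ≠ 0 → ∀ i,
      ‖Y i m‖ ≤ majConst i * (η * (((m : ℝ) ^ 2)⁻¹ * R ^ m)) * (1 + m * δ) ^ (i - 1) := by
  induction m using Nat.strong_induction_on with
  | _ m ih =>
  intro hm hm0
  refine norm_le_majConst_mul (u := fun i => Y i m) (by positivity) (by positivity)
    (h.zero_of_ne m hm0) fun i => ?_
  have hC := majConst_pos i
  have hcr := norm_crossSum_le (v := v) (y := Y i) (m := m) (e := i - 1) (C := majConst i)
    h0 hη0 hR hC.le h.v_zero (fun j hj => hv j (hj.trans hm))
    fun j hj hj0 => ih j hj (hj.trans hm) hj0 i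
  set W := η * (((m : ℝ) ^ 2)⁻¹ * R ^ m) with hW
  have hW0 : 0 ≤ W := by positivity
  have hp : 1 ≤ (1 + m * δ) ^ (i - 1) := one_le_pow₀ (by nlinarith [Nat.cast_nonneg (α := ℝ) m])
  show ‖Y (i + 1) m‖ ≤ (1 + i + m * δ) * ‖Y i m‖ + _
  rw [h.succ, sum_antidiagonal_eq_add_crossSum]
  have t1 : ‖(1 - (i + m) * δ : ℂ) * Y i m‖ ≤ (1 + i + m * δ) * ‖Y i m‖ := by
    rw [norm_mul]; gcongr; exact norm_factor_le h0 h1 i m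
  have t2 : ‖v m * Y i 0‖ ≤ majConst i * W * (1 + m * δ) ^ (i - 1) := by
    rw [norm_mul]
    calc _ ≤ W * majConst i := by
          gcongr
          · exact hv m hm
          · exact h.norm_apply_zero_le h0 h1 i
      _ = majConst i * W * 1 := by ring
      _ ≤ _ := by gcongr
  have t3 : 8 * majConst i * (η * W) * (1 + m * δ) ^ (i - 1)
      ≤ 8 * majConst i * W * (1 + m * δ) ^ (i - 1) := by
    gcongr
    exact mul_le_of_le_one_left hW0 hη1
  refine (norm_add_le _ _).trans (add_le_add t1 ((norm_add_le _ _).trans ?_))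
  linarith

/-- `fallingDiff` absorbs exactly the part of `Y i m` linear in `v m`. The rest is driven by
products of two lower coefficients, hence the second factor `η`. -/
theorem norm_apply_sub_le (h : IsRiccatiFamily δ v Y) (h0 : 0 ≤ δ) (h1 : δ ≤ 1) {η R : ℝ}
    (hη0 : 0 ≤ η) (hη1 : η ≤ 1) (hR : 0 ≤ R) {m : ℕ} (hm : m ≠ 0)
    (hv : ∀ j < m, ‖v j‖ ≤ η * (((j : ℝ) ^ 2)⁻¹ * R ^ j)) (i : ℕ) :
    ‖Y i m - fallingDiff δ (m * δ) i * v m‖ ≤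
      majConst i * (η * (η * (((m : ℝ) ^ 2)⁻¹ * R ^ m))) * (1 + m * δ) ^ (i - 1) := by
  refine norm_le_majConst_mul (u := fun i => Y i m - fallingDiff δ (m * δ) i * v m)
    (by positivity) (by positivity) (by simp [h.zero_of_ne m hm, fallingDiff]) (fun i => ?_) i
  have hC := majConst_pos i
  have hcr := norm_crossSum_le (v := v) (y := Y i) (m := m) (e := i - 1) (C := majConst i)
    h0 hη0 hR hC.le h.v_zero hv
    fun j hj hj0 => h.norm_apply_le h0 h1 hη0 hη1 hR hv j hj hj0 i
  set W := η * (((m : ℝ) ^ 2)⁻¹ * R ^ m) with hW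
  have hW0 : 0 ≤ W := by positivity
  have e : Y (i + 1) m - fallingDiff δ (m * δ) (i + 1) * v m
      = (1 - (i + m) * δ) * (Y i m - fallingDiff δ (m * δ) i * v m) + crossSum v (Y i) m := by
    rw [h.succ, sum_antidiagonal_eq_add_crossSum, h.apply_zero, fallingDiff]
    push_cast
    ring
  rw [e]
  refine (norm_add_le _ _).trans (add_le_add ?_ (hcr.trans ?_))
  · rw [norm_mul]; gcongr; exact norm_factor_le h0 h1 i m
  · gcongr; norm_num

/-- Lowering the index by `j ≥ 1` gains a factor `1 / R`; the weight loses at most `(k + 1) ^ 2`,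
since `m ≤ (k + 1) * l` when `l > 0` and `m ≤ k` when `l = 0`. -/
theorem norm_lower_term_le (h : IsRiccatiFamily δ v Y) (h0 : 0 ≤ δ) (h1 : δ ≤ 1) {η R : ℝ}
    (hη0 : 0 ≤ η) (hη1 : η ≤ 1) (hR : 1 ≤ R) {m k j l : ℕ} (hjl : j + l = m) (hj : j ≠ 0)
    (hjk : j ≤ k) (hv : ∀ j < m, ‖v j‖ ≤ η * (((j : ℝ) ^ 2)⁻¹ * R ^ j)) (i : ℕ) :
    ‖Y i l‖ ≤ majConst i * (((k + 1) ^ 2 / R) * (((m : ℝ) ^ 2)⁻¹ * R ^ m)) *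
      (1 + m * δ) ^ (i - 1) := by
  subst hjl
  have hC := majConst_pos i
  have hR0 : 0 < R := by linarith
  have hm0 : (0 : ℝ) < (j + l : ℕ) := by exact_mod_cast Nat.add_pos_left (Nat.pos_of_ne_zero hj) l
  have hp : 1 ≤ (1 + (j + l : ℕ) * δ) ^ (i - 1) := one_le_pow₀ (by nlinarith)
  have hRp : R * R ^ l ≤ R ^ (j + l) := by
    rw [← pow_succ']; exact pow_le_pow_right₀ hR (by omega)
  rcases Nat.eq_zero_or_pos l with rfl | hl
  · have hmk : ((j + 0 : ℕ) : ℝ) ≤ k + 1 := by exact_mod_cast (by omega : j + 0 ≤ k + 1)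
    have : 1 ≤ ((k + 1 : ℝ) ^ 2 / R) * ((((j + 0 : ℕ) : ℝ) ^ 2)⁻¹ * R ^ (j + 0)) := by
      have e : ((k + 1 : ℝ) ^ 2 / R) * ((((j + 0 : ℕ) : ℝ) ^ 2)⁻¹ * R ^ (j + 0))
        = ((k + 1 : ℝ) ^ 2 * R ^ (j + 0)) / (((j + 0 : ℕ) : ℝ) ^ 2 * R) := by field_simp
      rw [e, one_le_div (by positivity)]
      gcongr
      simpa using hRp
    calc ‖Y i 0‖ ≤ majConst i * 1 * 1 := by simpa using h.norm_apply_zero_le h0 h1 i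
      _ ≤ _ := by gcongr
  · have hl0 : (0 : ℝ) < l := by exact_mod_cast hl
    have hle : (l : ℝ) ≤ (j + l : ℕ) := by exact_mod_cast Nat.le_add_left l j
    refine (h.norm_apply_le h0 h1 hη0 hη1 hR0.le hv l (by omega) hl.ne' i).trans ?_
    have hml : ((j + l : ℕ) : ℝ) ≤ (k + 1) * l := by
      have : j + l ≤ (k + 1) * l := by nlinarith
      exact_mod_cast this
    have e : η * (((l : ℝ) ^ 2)⁻¹ * R ^ l) ≤
        ((k + 1 : ℝ) ^ 2 / R) * ((((j + l : ℕ) : ℝ) ^ 2)⁻¹ * R ^ (j + l)) := by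
      have e1 : ((l : ℝ) ^ 2)⁻¹ ≤ (k + 1 : ℝ) ^ 2 * (((j + l : ℕ) : ℝ) ^ 2)⁻¹ := by
        rw [← div_eq_mul_inv, inv_eq_one_div, div_le_div_iff₀ (by positivity) (by positivity),
          one_mul, ← mul_pow]
        gcongr
      have e2 : R ^ l ≤ R ^ (j + l) / R := by rw [le_div_iff₀ hR0]; linarith
      calc η * (((l : ℝ) ^ 2)⁻¹ * R ^ l)
          ≤ 1 * ((k + 1 : ℝ) ^ 2 * (((j + l : ℕ) : ℝ) ^ 2)⁻¹ * (R ^ (j + l) / R)) := by gcongr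
        _ = _ := by ring
    gcongr

/-- Uniform geometric bound for the solutions of a nonresonant Riccati-type hierarchy. -/
theorem exists_norm_le (k : ℕ) {c M : ℝ} (hc : 0 < c) (hM : 0 ≤ M) :
    ∃ R : ℝ, 1 ≤ R ∧ ∀ (δ : ℝ) (v : ℕ → ℂ) (Y : ℕ → ℕ → ℂ) (d : Fin (k + 1) → ℕ → ℂ),
      0 ≤ δ → δ ≤ 1 → IsRiccatiFamily δ v Y → (∀ i j, ‖d i j‖ ≤ M) → (∀ i j, k < j → d i j = 0) →
      (∀ m, ∑ i : Fin (k + 1), ∑ x ∈ Finset.HasAntidiagonal.antidiagonal m, d i x.1 * Y i x.2 = 0) →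
      (∀ m : ℕ, c * (1 + m * δ) ^ (k - 1) ≤
        ‖∑ i : Fin (k + 1), d i 0 * (fallingDiff δ (m * δ) i : ℂ)‖) →
      ∀ m, ‖v m‖ ≤ R ^ m := by
  have hCk := majConst_pos k
  -- First `η` is taken small, so that the quadratic terms use half of `c * η`; then `R` is taken
  -- large, so that the lower coefficients of the `d i` use the other half. The summand `1` keeps
  -- `G` positive.
  set G : ℝ := (k + 1) * M * majConst k + 1 with hG
  have hG0 : 0 < G := by positivity
  set η : ℝ := min 1 (c / (2 * G)) with hη
  have hη0 : 0 < η := by positivity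
  have hη1 : η ≤ 1 := min_le_left _ _
  have hηc : G * η ≤ c / 2 := by
    calc G * η ≤ G * (c / (2 * G)) := by gcongr; exact min_le_right _ _
      _ = c / 2 := by field_simp
  set R : ℝ := max 1 (2 * (k + 1) ^ 3 * G / (c * η)) with hR
  have hR1 : 1 ≤ R := le_max_left _ _
  have hR0 : 0 < R := by linarith
  have hRc : G * ((k + 1) ^ 3 / R) ≤ c * η / 2 := by
    have h2 : 2 * (k + 1) ^ 3 * G / (c * η) ≤ R := le_max_right _ _
    rw [div_le_iff₀ (by positivity)] at h2
    rw [← mul_div_assoc, div_le_iff₀ hR0]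
    linarith
  refine ⟨R, hR1, fun δ v Y d h0 h1 h hd hdk heq hlow m => ?_⟩
  have main : ‖v m‖ ≤ η * (((m : ℝ) ^ 2)⁻¹ * R ^ m) := by
    induction m using Nat.strong_induction_on with
    | _ m hv =>
    rcases eq_or_ne m 0 with rfl | hm
    · simp [h.v_zero]
    set U : ℝ := ((m : ℝ) ^ 2)⁻¹ * R ^ m with hU
    set P : ℝ := (1 + m * δ) ^ (k - 1) with hP
    have hU0 : 0 ≤ U := by positivity
    have hP0 : 0 < P := by positivity
    have hPi : ∀ i : Fin (k + 1), (1 + m * δ) ^ ((i : ℕ) - 1) ≤ P := fun i =>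
      pow_le_pow_right₀ (by nlinarith [Nat.cast_nonneg (α := ℝ) m]) (by have := i.is_lt; omega)
    have hCi : ∀ i : Fin (k + 1), majConst i ≤ majConst k := fun i =>
      monotone_majConst (Nat.le_of_lt_succ i.is_lt)
    obtain ⟨m', rfl⟩ := Nat.exists_eq_succ_of_ne_zero hm
    set m := m' + 1
    -- The `m`-th equation solved for its part linear in `v m`.
    have hsplit : (∑ i : Fin (k + 1), d i 0 * (fallingDiff δ (m * δ) i : ℂ)) * v m
        = - ∑ i : Fin (k + 1), (d i 0 * (Y i m - fallingDiff δ (m * δ) i * v m)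
          + ∑ x ∈ Finset.HasAntidiagonal.antidiagonal m', d i (x.1 + 1) * Y i x.2) := by
      have := heq m
      simp only [m, Finset.Nat.sum_antidiagonal_succ] at this
      rw [← sub_eq_zero, sub_neg_eq_add, Finset.sum_mul, ← Finset.sum_add_distrib, ← this]
      refine Finset.sum_congr rfl fun i _ => ?_
      ring
    have hterm1 : ∀ i : Fin (k + 1), ‖d i 0 * (Y i m - fallingDiff δ (m * δ) i * v m)‖ ≤
        M * majConst k * P * (η ^ 2 * U) := by
      intro i
      have := h.norm_apply_sub_le h0 h1 hη0.le hη1 hR0.le hm hv i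
      have hCi0 := majConst_pos i
      rw [norm_mul]
      calc _ ≤ M * (majConst k * (η * (η * U)) * P) := by
            refine mul_le_mul (hd i 0) (this.trans ?_) (norm_nonneg _) hM
            gcongr
            · exact hCi i
            · exact hPi i
        _ = _ := by ring
    have hterm2 : ∀ i : Fin (k + 1),
        ‖∑ x ∈ Finset.HasAntidiagonal.antidiagonal m', d i (x.1 + 1) * Y i x.2‖ ≤
        M * majConst k * P * ((k + 1) ^ 3 / R * U) := by
      intro i
      have hCi0 := majConst_pos i
      have hx : ∀ x ∈ Finset.HasAntidiagonal.antidiagonal m', ‖d i (x.1 + 1) * Y i x.2‖ ≤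
          if x.1 ∈ Finset.range k then M * majConst k * P * ((k + 1) ^ 2 / R * U) else 0 := by
        intro x hx
        have hx' := Finset.HasAntidiagonal.mem_antidiagonal.1 hx
        split_ifs with hxk
        · have := h.norm_lower_term_le (k := k) (j := x.1 + 1) (l := x.2) (m := m) h0 h1 hη0.le hη1
            hR1 (by omega) (by omega) (by have := Finset.mem_range.1 hxk; omega) hv i
          rw [norm_mul]
          calc _ ≤ M * (majConst k * ((k + 1) ^ 2 / R * U) * P) := by
                refine mul_le_mul (hd i _) (this.trans ?_) (norm_nonneg _) hM
                gcongr
                · exact hCi i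
                · exact hPi i
            _ = _ := by ring
        · rw [hdk i _ (by simp at hxk; omega), zero_mul, norm_zero]
      refine (norm_sum_le_of_le _ hx).trans ?_
      rw [Finset.Nat.sum_antidiagonal_eq_sum_range_succ_mk, ← Finset.sum_filter, Finset.sum_const,
        nsmul_eq_mul]
      have hcard : (((Finset.range m'.succ).filter fun j => j ∈ Finset.range k).card : ℝ)
          ≤ k + 1 := by
        have : ((Finset.range m'.succ).filter fun j => j ∈ Finset.range k).card ≤ k := by
          calc _ ≤ (Finset.range k).card :=
                Finset.card_le_card fun j hj => (Finset.mem_filter.1 hj).2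
            _ = k := Finset.card_range k
        exact_mod_cast this.trans (Nat.le_succ k)
      calc _ ≤ (k + 1) * (M * majConst k * P * ((k + 1) ^ 2 / R * U)) := by gcongr
        _ = _ := by ring
    have hnorm : c * P * ‖v m‖ ≤ (k + 1) * (M * majConst k * P * (η ^ 2 * U)
        + M * majConst k * P * ((k + 1) ^ 3 / R * U)) := by
      calc c * P * ‖v m‖ ≤ ‖(∑ i : Fin (k + 1), d i 0 * (fallingDiff δ (m * δ) i : ℂ)) * v m‖ := by
            rw [norm_mul]; gcongr; exact hlow m
        _ ≤ ∑ i : Fin (k + 1), (M * majConst k * P * (η ^ 2 * U)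
            + M * majConst k * P * ((k + 1) ^ 3 / R * U)) := by
            rw [hsplit, norm_neg]
            exact norm_sum_le_of_le _ fun i _ =>
              (norm_add_le _ _).trans (add_le_add (hterm1 i) (hterm2 i))
        _ = _ := by simp [mul_add]
    have hfin : c * P * ‖v m‖ ≤ c * P * (η * U) := by
      calc _ ≤ _ := hnorm
        _ = (G - 1) * P * U * (η ^ 2 + (k + 1) ^ 3 / R) := by rw [hG]; ring
        _ ≤ G * P * U * (η ^ 2 + (k + 1) ^ 3 / R) := by gcongr; linarith
        _ = ((G * η) * η + G * ((k + 1) ^ 3 / R)) * (P * U) := by ring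
        _ ≤ (c / 2 * η + c * η / 2) * (P * U) := by gcongr
        _ = _ := by ring
    exact le_of_mul_le_mul_left hfin (by positivity)
  refine main.trans ?_
  have : ((m : ℝ) ^ 2)⁻¹ ≤ 1 := by
    rcases Nat.eq_zero_or_pos m with rfl | hm
    · simp
    · exact inv_le_one_of_one_le₀ (one_le_pow₀ (by exact_mod_cast hm))
  calc η * (((m : ℝ) ^ 2)⁻¹ * R ^ m) ≤ 1 * (1 * R ^ m) := by gcongr
    _ = R ^ m := by ring

end IsRiccatiFamily

/-! ### Power sums and expansions at infinity -/

/-- If the power sums of a multiset grow at most like `R ^ m`, the multiset lies in the disk of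
radius `R`. -/
theorem norm_le_of_norm_sum_pow_le {s : Multiset ℂ} {A R : ℝ} (hR : 0 < R)
    (h : ∀ m : ℕ, ‖(s.map (· ^ m)).sum‖ ≤ A * R ^ m) {z : ℂ} (hz : z ∈ s) : ‖z‖ ≤ R := by
  by_contra hlt
  rw [not_le] at hlt
  -- Combining shifted power sums with the coefficients of `g` isolates `z ^ m`, since `g` vanishes
  -- at every other element of `s`.
  set g : ℂ[X] := ∏ w ∈ s.toFinset.erase z, (X - C w) with hg
  have hgz : g.eval z ≠ 0 := by
    rw [hg, eval_prod, Finset.prod_ne_zero_iff]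
    intro w hw
    simpa [sub_eq_zero] using (Finset.ne_of_mem_erase hw).symm
  set D : ℝ := ∑ l ∈ Finset.range (g.natDegree + 1), ‖g.coeff l‖ * (A * R ^ l)
  have hc : 0 < ‖(s.count z : ℂ) * g.eval z‖ := by
    rw [norm_pos_iff]
    exact mul_ne_zero (by exact_mod_cast (Multiset.count_pos.2 hz).ne') hgz
  have key : ∀ m : ℕ, ‖(s.count z : ℂ) * g.eval z‖ * ‖z‖ ^ m ≤ D * R ^ m := by
    intro m
    have e : (s.count z : ℂ) * g.eval z * z ^ m
        = ∑ l ∈ Finset.range (g.natDegree + 1), g.coeff l * (s.map (· ^ (m + l))).sum := by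
      have e1 : ∑ l ∈ Finset.range (g.natDegree + 1), g.coeff l * (s.map (· ^ (m + l))).sum
          = ∑ w ∈ s.toFinset, (s.count w : ℂ) * g.eval w * w ^ m := by
        simp only [Finset.sum_multiset_map_count, Finset.mul_sum]
        rw [Finset.sum_comm]
        refine Finset.sum_congr rfl fun w _ => ?_
        rw [eval_eq_sum_range, Finset.mul_sum, Finset.sum_mul]
        refine Finset.sum_congr rfl fun l _ => ?_
        rw [nsmul_eq_mul, pow_add]
        ring
      rw [e1, Finset.sum_eq_single_of_mem z (Multiset.mem_toFinset.2 hz)]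
      intro w hw hwz
      have : g.eval w = 0 := by
        rw [hg, eval_prod]
        exact Finset.prod_eq_zero (Finset.mem_erase.2 ⟨hwz, hw⟩) (by simp)
      rw [this, mul_zero, zero_mul]
    rw [← norm_pow, ← norm_mul, e, Finset.sum_mul]
    refine norm_sum_le_of_le _ fun l _ => ?_
    rw [norm_mul]
    calc _ ≤ ‖g.coeff l‖ * (A * R ^ (m + l)) := by gcongr; exact h _
      _ = _ := by rw [pow_add]; ring
  obtain ⟨m, hm⟩ := pow_unbounded_of_one_lt (D / ‖(s.count z : ℂ) * g.eval z‖)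
    ((one_lt_div hR).2 hlt)
  rw [div_pow, div_lt_div_iff₀ hc (by positivity)] at hm
  have := key m
  linarith

theorem reverse_X_sub_C (a : ℂ) : (X - C a : ℂ[X]).reverse = 1 - C a * X := by
  rw [reverse, natDegree_X_sub_C, reflect_sub, reflect_C, pow_one]
  congr 1
  simp

theorem reverse_multiset_prod_X_sub_C (s : Multiset ℂ) :
    ((s.map (X - C ·)).prod : ℂ[X]).reverse = (s.map (1 - C · * X)).prod := by
  induction s using Multiset.induction with
  | empty => simpa using reverse_C (1 : ℂ)
  | cons a s ih => simp [reverse_mul_of_domain, reverse_X_sub_C, ih]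

theorem reverse_eq_prod_roots (p : ℂ[X]) :
    p.reverse = C p.leadingCoeff * (p.roots.map (1 - C · * X)).prod := by
  conv_lhs => rw [(IsAlgClosed.splits p).eq_prod_roots]
  rw [reverse_mul_of_domain, reverse_C, reverse_multiset_prod_X_sub_C]

/-- The generating series of the power sums of positive order. -/
noncomputable def powerSumSeries (s : Multiset ℂ) : PowerSeries ℂ :=
  PowerSeries.mk fun m => if m = 0 then 0 else (s.map (· ^ m)).sum

theorem powerSumSeries_singleton_mul (a : ℂ) :
    powerSumSeries {a} * (1 - PowerSeries.C a * PowerSeries.X) = PowerSeries.C a * PowerSeries.X := by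
  ext m
  rw [mul_sub, mul_one, ← mul_assoc, map_sub]
  rcases m with _ | m
  · simp [powerSumSeries]
  · rw [PowerSeries.coeff_succ_mul_X, PowerSeries.coeff_mul_C, PowerSeries.coeff_succ_mul_X,
      PowerSeries.coeff_C]
    rcases m with _ | m <;> simp [powerSumSeries, pow_succ]

/-- Logarithmic differentiation of the product, cleared of denominators. -/
theorem powerSumSeries_mul_prod (s : Multiset ℂ) :
    powerSumSeries s * (((s.map (1 - C · * X)).prod : ℂ[X]) : PowerSeries ℂ) =
      -(PowerSeries.X * PowerSeries.derivative ℂ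
        (((s.map (1 - C · * X)).prod : ℂ[X]) : PowerSeries ℂ)) := by
  induction s using Multiset.induction with
  | empty =>
    have : powerSumSeries 0 = 0 := by ext m; simp [powerSumSeries]
    simp [this]
  | cons a s ih =>
    have h1 : powerSumSeries (a ::ₘ s) = powerSumSeries {a} + powerSumSeries s := by
      ext m; by_cases hm : m = 0 <;> simp [powerSumSeries, hm]
    have h2 := powerSumSeries_singleton_mul a
    rw [Multiset.map_cons, Multiset.prod_cons, coe_mul, Derivation.leibniz, h1]
    have h3 : ((1 - C a * X : ℂ[X]) : PowerSeries ℂ) = 1 - PowerSeries.C a * PowerSeries.X := by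
      simp
    have h4 : PowerSeries.derivative ℂ (1 - PowerSeries.C a * PowerSeries.X)
        = - PowerSeries.C a := by
      simp
    rw [h3, h4, smul_eq_mul, smul_eq_mul]
    linear_combination (((s.map (1 - C · * X)).prod : ℂ[X]) : PowerSeries ℂ) * h2
      + (1 - PowerSeries.C a * PowerSeries.X) * ih

theorem powerSumSeries_roots_mul_reverse (p : ℂ[X]) :
    powerSumSeries p.roots * (p.reverse : PowerSeries ℂ) =
      -(PowerSeries.X * PowerSeries.derivative ℂ (p.reverse : PowerSeries ℂ)) := by
  have h := powerSumSeries_mul_prod p.roots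
  rw [reverse_eq_prod_roots, coe_mul, coe_C, Derivation.leibniz, PowerSeries.derivative_C,
    smul_zero, add_zero, smul_eq_mul]
  linear_combination PowerSeries.C p.leadingCoeff * h

theorem reflect_derivative {N : ℕ} {g : ℂ[X]} (hg : g.natDegree ≤ N + 1) :
    reflect N (derivative g) =
      C ((N : ℂ) + 1) * reflect (N + 1) g - X * derivative (reflect (N + 1) g) := by
  ext m
  rw [coeff_sub, coeff_C_mul, coeff_reflect, coeff_derivative]
  have hX : (X * derivative (reflect (N + 1) g)).coeff m = m * (reflect (N + 1) g).coeff m := by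
    rcases m with _ | m
    · simp
    · rw [coeff_X_mul, coeff_derivative]; push_cast; ring
  rw [hX, coeff_reflect]
  rcases Nat.lt_trichotomy m (N + 1) with hm | rfl | hm
  · rw [revAt_le (by omega : m ≤ N), revAt_le hm.le, Nat.sub_add_comm (by omega : m ≤ N)]
    have : ((N - m : ℕ) : ℂ) = N - m := by rw [Nat.cast_sub (by omega)]
    rw [this]; ring
  · rw [revAt_eq_self_of_lt (Nat.lt_succ_self N), coeff_eq_zero_of_natDegree_lt (by omega)]
    push_cast; ring
  · rw [revAt_eq_self_of_lt (by omega), revAt_eq_self_of_lt hm,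
      coeff_eq_zero_of_natDegree_lt (by omega), coeff_eq_zero_of_natDegree_lt (by omega)]
    ring

theorem reflect_sum {ι : Type*} (N : ℕ) (s : Finset ι) (f : ι → ℂ[X]) :
    reflect N (∑ i ∈ s, f i) = ∑ i ∈ s, reflect N (f i) := by
  ext m
  simp [coeff_reflect, finsetSum_coeff]

/-- The series of `z ^ i p ^ (i) / (n ^ i p)` in `1 / z`, for `z p' / (n p) = 1 + v` and
`δ = 1 / n`. -/
noncomputable def riccatiSeries (δ : ℂ) (v : PowerSeries ℂ) : ℕ → PowerSeries ℂ
  | 0 => 1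
  | i + 1 => (1 + v - PowerSeries.C (i * δ)) * riccatiSeries δ v i -
      PowerSeries.C δ * (PowerSeries.X * PowerSeries.derivative ℂ (riccatiSeries δ v i))

theorem coeff_X_mul_derivative (f : PowerSeries ℂ) (m : ℕ) :
    PowerSeries.coeff m (PowerSeries.X * PowerSeries.derivative ℂ f)
      = m * PowerSeries.coeff m f := by
  rcases m with _ | m
  · simp
  · rw [PowerSeries.coeff_succ_X_mul, PowerSeries.coeff_derivative]; push_cast; ring

theorem isRiccatiFamily_riccatiSeries (δ : ℝ) {v : PowerSeries ℂ}
    (hv : PowerSeries.coeff 0 v = 0) :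
    IsRiccatiFamily δ (fun m => PowerSeries.coeff m v)
      fun i m => PowerSeries.coeff m (riccatiSeries δ v i) where
  v_zero := hv
  zero_zero := by simp [riccatiSeries]
  zero_of_ne m hm := by simp [riccatiSeries, PowerSeries.coeff_one, hm]
  succ i m := by
    rw [riccatiSeries, sub_mul, add_mul, one_mul, map_sub, map_sub, map_add,
      PowerSeries.coeff_C_mul, PowerSeries.coeff_C_mul, coeff_X_mul_derivative,
      PowerSeries.coeff_mul]
    ring

/-- This identifies the formal series with the quotients of derivatives of `p`, written in `1 / z`
and multiplied by `reflect n p`. -/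
theorem riccatiSeries_mul_reflect {n : ℕ} {δ : ℂ} (hδ : n * δ = 1) {p : ℂ[X]}
    (hp : p.natDegree ≤ n) {v : PowerSeries ℂ}
    (hv : v * (reflect n p : PowerSeries ℂ) = -(PowerSeries.C δ *
      (PowerSeries.X * PowerSeries.derivative ℂ (reflect n p : PowerSeries ℂ)))) (i : ℕ) :
    i ≤ n → riccatiSeries δ v i * (reflect n p : PowerSeries ℂ) =
      PowerSeries.C (δ ^ i) * (reflect (n - i) (derivative^[i] p) : PowerSeries ℂ) := by
  induction i with
  | zero => intro _; simp [riccatiSeries]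
  | succ i ih =>
    intro hi
    obtain ⟨N, hN⟩ : ∃ N, n - i = N + 1 := ⟨n - i - 1, by omega⟩
    have hN' : n - (i + 1) = N := by omega
    have hdeg : (derivative^[i] p).natDegree ≤ N + 1 :=
      (natDegree_iterate_derivative p i).trans (by omega)
    have h1 := ih (by omega)
    have h2 := congrArg (PowerSeries.derivative ℂ) h1
    rw [Derivation.leibniz, Derivation.leibniz, PowerSeries.derivative_C, smul_zero, add_zero,
      smul_eq_mul, smul_eq_mul, smul_eq_mul, PowerSeries.derivative_coe (reflect (n - i) _)] at h2
    rw [hN', Function.iterate_succ_apply', reflect_derivative hdeg, ← hN, coe_sub, coe_mul, coe_mul,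
      coe_C, coe_X, riccatiSeries]
    have hc : PowerSeries.C δ * PowerSeries.C ((N : ℂ) + 1) = 1 - PowerSeries.C (i * δ) := by
      have : (N : ℂ) + 1 = n - i := by
        rw [← Nat.cast_sub (by omega), hN]; push_cast; ring
      rw [← map_mul, this, ← map_one PowerSeries.C, ← map_sub]
      congr 1
      linear_combination hδ
    have hpow : PowerSeries.C (δ ^ (i + 1)) = PowerSeries.C (δ ^ i) * PowerSeries.C δ := by
      rw [pow_succ, map_mul]
    rw [hpow]
    linear_combination (1 - PowerSeries.C (i * δ)) * h1 + riccatiSeries δ v i * hv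
      - PowerSeries.C δ * PowerSeries.X * h2
      - PowerSeries.C (δ ^ i) * (reflect (n - i) (derivative^[i] p) : PowerSeries ℂ) * hc

theorem scaledFalling_mem_Icc {n : ℕ} {δ : ℝ} (hδ0 : 0 ≤ δ) (hδ : n * δ = 1) (i : ℕ) :
    i ≤ n → 0 ≤ scaledFalling δ i ∧ scaledFalling δ i ≤ 1 := by
  induction i with
  | zero => intro _; simp [scaledFalling]
  | succ i ih =>
    intro hi
    obtain ⟨h0, h1⟩ := ih (by omega)
    have h2 : i * δ ≤ 1 := by
      rw [← hδ]; gcongr; omega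
    have h3 : 0 ≤ i * δ := by positivity
    rw [scaledFalling]
    exact ⟨mul_nonneg (by linarith) h0, mul_le_one₀ (by linarith) h0 h1⟩

/-! ### Root bounds for eigenpolynomials -/

namespace HomogenizedPencil

variable {k : ℕ} {T : HomogenizedPencil k}

theorem sum_reflect_mul_riccatiSeries_eq_zero {n : ℕ} {δ lam : ℂ} (hδ : n * δ = 1) (hkn : k ≤ n)
    {p : ℂ[X]} (hp : p.natDegree = n) (hp0 : T.IsEigenpolynomial lam p) :
    ∑ i : Fin (k + 1), PowerSeries.C ((δ * lam) ^ (k - (i : ℕ))) *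
      (reflect i (T.Q i) : PowerSeries ℂ) *
        riccatiSeries δ (PowerSeries.C δ * powerSumSeries p.roots) i = 0 := by
  have hrev : p.reverse = reflect n p := by rw [reverse, hp]
  have hne : (reflect n p : PowerSeries ℂ) ≠ 0 := by
    rw [Ne, coe_eq_zero_iff, reflect_eq_zero_iff]
    exact hp0.1
  have hv : PowerSeries.C δ * powerSumSeries p.roots * (reflect n p : PowerSeries ℂ) =
      -(PowerSeries.C δ *
        (PowerSeries.X * PowerSeries.derivative ℂ (reflect n p : PowerSeries ℂ))) := by
    have := powerSumSeries_roots_mul_reverse p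
    rw [hrev] at this
    linear_combination PowerSeries.C δ * this
  have hop : ∑ i : Fin (k + 1), (reflect i (T.Q i) : PowerSeries ℂ) *
      PowerSeries.C (lam ^ (k - (i : ℕ))) *
        (reflect (n - i) (derivative^[(i : ℕ)] p) : PowerSeries ℂ) = 0 := by
    have h := congrArg (fun f => (reflect n f : PowerSeries ℂ)) hp0.2
    simp only [op, reflect_sum, reflect_zero, coe_zero] at h
    rw [← coeToPowerSeries.ringHom_apply, map_sum] at h
    rw [← h]
    refine Finset.sum_congr rfl fun i _ => ?_
    have hi : (i : ℕ) ≤ n := (Nat.le_of_lt_succ i.is_lt).trans hkn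
    have e : reflect n (T.Q i * C (lam ^ (k - (i : ℕ))) * derivative^[(i : ℕ)] p)
        = reflect i (T.Q i) * C (lam ^ (k - (i : ℕ))) *
          reflect (n - i) (derivative^[(i : ℕ)] p) := by
      conv_lhs => rw [← Nat.add_sub_cancel' hi]
      rw [reflect_mul _ _ ((natDegree_mul_C_le _ _).trans (T.natDegree_le i))
        ((natDegree_iterate_derivative p i).trans (by omega)), mul_comm (T.Q i), reflect_C_mul,
        mul_comm (C _)]
    rw [e]
    simp
  refine (mul_eq_zero.1 ?_).resolve_right hne
  have h2 := congrArg (fun f => PowerSeries.C (δ ^ k) * f) hop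
  simp only [mul_zero, Finset.mul_sum] at h2
  rw [Finset.sum_mul, ← h2]
  refine Finset.sum_congr rfl fun i _ => ?_
  have hi : (i : ℕ) ≤ k := Nat.le_of_lt_succ i.is_lt
  have h3 := riccatiSeries_mul_reflect hδ hp.le hv i (hi.trans hkn)
  have e : PowerSeries.C (δ ^ k) = PowerSeries.C (δ ^ (k - (i : ℕ))) * PowerSeries.C (δ ^ (i : ℕ)) := by
    rw [← map_mul, ← pow_add, Nat.sub_add_cancel hi]
  rw [e, mul_pow, map_mul]
  linear_combination PowerSeries.C (δ ^ (k - (i : ℕ))) * PowerSeries.C (lam ^ (k - (i : ℕ))) *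
    (reflect i (T.Q i) : PowerSeries ℂ) * h3

theorem sum_lead_mul_descFactorial_eq_zero {n : ℕ} {lam : ℂ} {p : ℂ[X]} (hp : p.natDegree = n)
    (hp0 : T.IsEigenpolynomial lam p) :
    ∑ i : Fin (k + 1), T.lead i * lam ^ (k - (i : ℕ)) * (n.descFactorial i : ℂ) = 0 := by
  have hl : p.coeff n ≠ 0 := by rw [← hp]; simpa using hp0.1
  have h := congrArg (fun f => f.coeff n) hp0.2
  simp only [op, finsetSum_coeff, coeff_zero] at h
  refine (mul_eq_zero.1 (Eq.trans ?_ h)).resolve_right hl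
  rw [Finset.sum_mul]
  refine Finset.sum_congr rfl fun i _ => ?_
  rcases le_or_gt (i : ℕ) n with hi | hi
  · have e := coeff_mul_add_eq_of_natDegree_le
      (f := T.Q i * C (lam ^ (k - (i : ℕ)))) (g := derivative^[(i : ℕ)] p) (df := i) (dg := n - i)
      ((natDegree_mul_C_le _ _).trans (T.natDegree_le i))
      ((natDegree_iterate_derivative p i).trans (by omega))
    rw [Nat.add_sub_cancel' hi] at e
    rw [e, coeff_mul_C, coeff_iterate_derivative, Nat.sub_add_cancel hi, nsmul_eq_mul, lead]
    ring
  · rw [Nat.descFactorial_of_lt hi, iterate_derivative_eq_zero (by omega)]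
    simp

namespace IsGeneralType

/-- The coefficient of `z ^ n` in `T_λ p = 0` is a polynomial equation for `lam`, nontrivial because
`a_{0,0} ≠ 0`. -/
theorem finite_eigenvalues (hT : T.IsGeneralType) (n : ℕ) :
    {lam : ℂ | ∃ p, T.IsEigenpolynomial lam p ∧ p.natDegree = n}.Finite := by
  set F : ℂ[X] := ∑ i : Fin (k + 1),
    C (T.lead i * (n.descFactorial i : ℂ)) * X ^ (k - (i : ℕ)) with hF
  have hF0 : F ≠ 0 := by
    intro h
    have h1 : F.coeff k = T.lead 0 := by
      simp only [hF, finsetSum_coeff, coeff_C_mul, coeff_X_pow]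
      rw [Finset.sum_eq_single 0]
      · simp
      · intro i _ hi
        have : (i : ℕ) ≠ 0 := fun h => hi (Fin.ext h)
        rw [if_neg (by have := i.is_lt; omega), mul_zero]
      · simp
    exact hT.lead_zero_ne (by rw [← h1, h, coeff_zero])
  refine (finite_setOfPred_isRoot hF0).subset ?_
  rintro lam ⟨p, hp0, hp⟩
  show F.eval lam = 0
  rw [← sum_lead_mul_descFactorial_eq_zero hp hp0, hF, eval_finsetSum]
  refine Finset.sum_congr rfl fun i _ => ?_
  simp
  ring

/-- The roots of all eigenpolynomials of large degree lie in one disk. -/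
theorem exists_norm_root_le (hT : T.IsGeneralType) :
    ∃ R : ℝ, 0 < R ∧ ∃ N : ℕ, ∀ n : ℕ, N ≤ n → ∀ (lam : ℂ) (p : ℂ[X]),
      T.IsEigenpolynomial lam p → p.natDegree = n → ∀ z : ℂ, p.IsRoot z → ‖z‖ ≤ R := by
  rcases eq_or_ne k 0 with rfl | hk
  · refine ⟨1, one_pos, 0, fun n _ lam p hp0 hp => ?_⟩
    have := sum_lead_mul_descFactorial_eq_zero hp hp0
    simp [hT.lead_zero_ne] at this
  obtain ⟨B, hB1, hB⟩ := hT.exists_norm_le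
  obtain ⟨c, hc, hlow⟩ := hT.exists_le_norm_sum_fallingDiff hk B
  set b : Fin (k + 1) → ℕ → ℂ := fun i j => (reflect i (T.Q i)).coeff j with hb
  have hbk : ∀ i j, k < j → b i j = 0 := by
    intro i j hj
    have hi := i.is_lt
    simp only [hb, coeff_reflect]
    rw [revAt_eq_self_of_lt (by omega)]
    exact coeff_eq_zero_of_natDegree_lt ((T.natDegree_le i).trans_lt (by omega))
  set M : ℝ := (∑ i, ∑ j ∈ Finset.range (k + 1), ‖b i j‖) * B ^ k with hM
  have hbM : ∀ i j, ‖b i j‖ ≤ ∑ i, ∑ j ∈ Finset.range (k + 1), ‖b i j‖ := by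
    intro i j
    rcases le_or_gt j k with hj | hj
    · calc ‖b i j‖ ≤ ∑ j ∈ Finset.range (k + 1), ‖b i j‖ :=
            Finset.single_le_sum (f := fun j => ‖b i j‖) (fun _ _ => norm_nonneg _)
              (Finset.mem_range.2 (by omega))
        _ ≤ _ := Finset.single_le_sum (f := fun i => ∑ j ∈ Finset.range (k + 1), ‖b i j‖)
              (fun _ _ => by positivity) (Finset.mem_univ i)
    · rw [hbk i j hj, norm_zero]; positivity
  obtain ⟨R, hR1, hR⟩ := IsRiccatiFamily.exists_norm_le k hc (M := M) (by positivity)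
  have hR0 : 0 < R := by linarith
  -- `n ≥ k` makes every `n - i` a true difference, and `n > 1 / c` puts `δ` in the range of the
  -- nonresonance bound.
  refine ⟨R, hR0, max k (⌈1 / c⌉₊ + 1), fun n hn lam p hp0 hp z hz => ?_⟩
  have hkn : k ≤ n := (le_max_left _ _).trans hn
  have hcn : ⌈1 / c⌉₊ + 1 ≤ n := (le_max_right _ _).trans hn
  have hn0 : (0 : ℝ) < n := by exact_mod_cast (by omega : 0 < n)
  set δ : ℝ := (n : ℝ)⁻¹ with hδ
  have hδ0 : 0 ≤ δ := by positivity
  have hnδ : n * δ = 1 := mul_inv_cancel₀ hn0.ne'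
  have hnδ' : (n : ℂ) * (δ : ℂ) = 1 := by exact_mod_cast hnδ
  have hδ1 : δ ≤ 1 := inv_le_one_of_one_le₀ (by exact_mod_cast (by omega : 1 ≤ n))
  have hδc : δ ≤ c := by
    have h1 : 1 / c ≤ n := (Nat.le_ceil _).trans (by exact_mod_cast (by omega))
    rw [div_le_iff₀ hc] at h1
    rw [hδ, inv_eq_one_div, div_le_iff₀ hn0]
    linarith
  set t : ℂ := δ * lam with ht
  set v : PowerSeries ℂ := PowerSeries.C (δ : ℂ) * powerSumSeries p.roots with hv
  have hv0 : PowerSeries.coeff 0 v = 0 := by simp [hv, powerSumSeries]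
  have hfam := isRiccatiFamily_riccatiSeries δ hv0
  have heq : ∀ m, ∑ i : Fin (k + 1), ∑ x ∈ Finset.HasAntidiagonal.antidiagonal m,
      (t ^ (k - (i : ℕ)) * b i x.1) * PowerSeries.coeff x.2 (riccatiSeries δ v i) = 0 := by
    intro m
    have h := congrArg (PowerSeries.coeff m)
      (sum_reflect_mul_riccatiSeries_eq_zero hnδ' hkn hp hp0)
    rw [map_sum, map_zero] at h
    rw [← h]
    refine Finset.sum_congr rfl fun i _ => ?_
    rw [PowerSeries.coeff_mul]
    refine Finset.sum_congr rfl fun x _ => ?_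
    rw [PowerSeries.coeff_C_mul, coeff_coe]
  have hb0 : ∀ i, b i 0 = T.lead i := by
    intro i
    simp [hb, coeff_reflect, revAt_le, lead]
  have hchar : ∑ i : Fin (k + 1), T.lead i * t ^ (k - (i : ℕ)) * (scaledFalling δ i : ℂ) = 0 := by
    rw [← heq 0]
    refine Finset.sum_congr rfl fun i _ => ?_
    rw [Finset.Nat.antidiagonal_zero, Finset.sum_singleton, hfam.apply_zero, hb0, mul_comm (T.lead i)]
  have htB : ‖t‖ ≤ B := by
    refine hB t (fun i => scaledFalling δ i) (fun i => ?_) (by simp [scaledFalling]) hchar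
    have := scaledFalling_mem_Icc hδ0 hnδ i ((Nat.le_of_lt_succ i.is_lt).trans hkn)
    rw [Complex.norm_of_nonneg this.1]
    exact this.2
  have hvR := hR δ (fun m => PowerSeries.coeff m v)
    (fun i m => PowerSeries.coeff m (riccatiSeries δ v i))
    (fun i j => t ^ (k - (i : ℕ)) * b i j) hδ0 hδ1 hfam
    (fun i j => by
      rw [norm_mul, norm_pow, mul_comm, hM]
      have : ‖t‖ ^ (k - (i : ℕ)) ≤ B ^ k :=
        (pow_le_pow_left₀ (norm_nonneg _) htB _).trans (pow_le_pow_right₀ hB1 (Nat.sub_le _ _))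
      gcongr
      exact hbM i j)
    (fun i j hj => by rw [hbk i j hj, mul_zero]) heq
    (fun m => by
      refine (hlow δ (m * δ) t hδ0 hδc (by positivity) htB hchar).trans_eq ?_
      congr 1
      refine Finset.sum_congr rfl fun i _ => ?_
      rw [hb0, mul_comm (T.lead i)])
  refine norm_le_of_norm_sum_pow_le (s := p.roots) (A := n) hR0 (fun m => ?_)
    ((mem_roots hp0.1).2 hz)
  rcases eq_or_ne m 0 with rfl | hm
  · have : p.roots.card ≤ n := hp ▸ card_roots' p
    simpa using this
  · have h1 : ‖(δ : ℂ) * (p.roots.map (· ^ m)).sum‖ ≤ R ^ m := by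
      have := hvR m
      simpa only [hv, PowerSeries.coeff_C_mul, powerSumSeries, PowerSeries.coeff_mk, if_neg hm]
        using this
    calc _ = ‖(n : ℂ) * ((δ : ℂ) * (p.roots.map (· ^ m)).sum)‖ := by
          rw [← mul_assoc, hnδ', one_mul]
      _ = n * ‖(δ : ℂ) * (p.roots.map (· ^ m)).sum‖ := by rw [norm_mul]; simp
      _ ≤ _ := by gcongr

/-- Uniqueness leaves one root set per eigenvalue. -/
theorem finite_roots_unique (hT : T.IsGeneralType) (n : ℕ) :
    {z : ℂ | ∃ lam p, T.IsUniqueEigenpolynomial lam p ∧ p.natDegree = n ∧ p.IsRoot z}.Finite := by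
  have h : ∀ lam : ℂ, {z : ℂ | ∃ p, T.IsUniqueEigenpolynomial lam p ∧ p.IsRoot z}.Finite := by
    intro lam
    by_cases hex : ∃ p, T.IsUniqueEigenpolynomial lam p
    · obtain ⟨p, hp⟩ := hex
      refine (finite_setOfPred_isRoot hp.1.1).subset ?_
      rintro z ⟨q, hq, hz⟩
      obtain ⟨c, rfl⟩ := hp.2 q hq.1.2
      have hc : c ≠ 0 := fun h => hq.1.1 (by simp [h])
      simpa [IsRoot, hc] using hz
    · refine Set.finite_empty.subset ?_
      rintro z ⟨q, hq, _⟩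
      exact hex ⟨q, hq⟩
  refine ((hT.finite_eigenvalues n).biUnion fun lam _ => h lam).subset ?_
  rintro z ⟨lam, p, hp, hpn, hz⟩
  exact Set.mem_biUnion (show lam ∈ {lam : ℂ | _} from ⟨p, hp.1, hpn⟩) ⟨p, hp, hz⟩

end IsGeneralType

end HomogenizedPencil

theorem mainTheorem3 (k : ℕ) (T : HomogenizedPencil k) (hT : T.IsGeneralType) :
    -- one disk for the whole pencil: it holds the roots of every eigenpolynomial of large degree
    -- and of every eigenpolynomial that is determined up to a factor by its eigenvalue
    (∃ R : ℝ, 0 < R ∧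
      (∃ N : ℕ, ∀ n : ℕ, N ≤ n → ∀ (lam : ℂ) (p : ℂ[X]),
        T.IsEigenpolynomial lam p → p.natDegree = n → ∀ z : ℂ, p.IsRoot z → ‖z‖ ≤ R) ∧
      (∀ (lam : ℂ) (p : ℂ[X]), T.IsUniqueEigenpolynomial lam p →
        ∀ z : ℂ, p.IsRoot z → ‖z‖ ≤ R)) ∧
    -- any choice of `k` eigenpolynomials `p n j` in each degree `n` (small degrees included,
    -- wherever they exist) has all its roots in one disk
    (∀ (lam : ℕ → Fin k → ℂ) (p : ℕ → Fin k → ℂ[X]),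
      ∃ R : ℝ, 0 < R ∧ ∀ (n : ℕ) (j : Fin k),
        T.IsEigenpolynomial (lam n j) (p n j) → (p n j).natDegree = n →
          ∀ z : ℂ, (p n j).IsRoot z → ‖z‖ ≤ R) := by
  obtain ⟨R, hR, N, hN⟩ := hT.exists_norm_root_le
  have enlarge {S : Set ℂ} (hS : S.Finite) : ∃ R' : ℝ, R ≤ R' ∧ ∀ z ∈ S, ‖z‖ ≤ R' := by
    obtain ⟨R', h⟩ := hS.isBounded.exists_norm_le
    exact ⟨max R R', le_max_left _ _, fun z hz => (h z hz).trans (le_max_right _ _)⟩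
  constructor
  · obtain ⟨R', hRR', hR'⟩ := enlarge ((Set.finite_lt_nat N).biUnion fun n _ => hT.finite_roots_unique n)
    refine ⟨R', hR.trans_le hRR', ⟨N, fun n hn lam p hp0 hp z hz =>
      (hN n hn lam p hp0 hp z hz).trans hRR'⟩, fun lam p hp z hz => ?_⟩
    rcases le_or_gt N p.natDegree with h | h
    · exact (hN _ h lam p hp.1 rfl z hz).trans hRR'
    · exact hR' z (Set.mem_biUnion (show p.natDegree ∈ {n | n < N} from h) ⟨lam, p, hp, rfl, hz⟩)
  · intro lam p
    have hfin : (⋃ n ∈ {n | n < N}, ⋃ j : Fin k, {z : ℂ | p n j ≠ 0 ∧ (p n j).IsRoot z}).Finite := by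
      refine (Set.finite_lt_nat N).biUnion fun n _ => Set.finite_iUnion fun j => ?_
      by_cases h : p n j = 0
      · simp [h]
      · exact (finite_setOfPred_isRoot h).subset fun z hz => hz.2
    obtain ⟨R', hRR', hR'⟩ := enlarge hfin
    refine ⟨R', hR.trans_le hRR', fun n j hp0 hp z hz => ?_⟩
    rcases le_or_gt N n with h | h
    · exact (hN n h _ _ hp0 hp z hz).trans hRR'
    · exact hR' z (Set.mem_biUnion (show n ∈ {n | n < N} from h)
        (Set.mem_iUnion.2 ⟨j, hp0.1, hz⟩))
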